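/- Let $k$ be an algebraically closed field of prime characteristic $p>0$, let $V$ be a finite-dimensional $k$-vector space, and let $G\subset\operatorname{GL}(V)$ be a finite subgroup whose order is not divisible by $p$ and which contains no pseudo-reflections (elements $g$ such that $g-1$ has rank one on $V$). Let $S=\operatorname{Sym}(V)$ be the symmetric algebra with the induced action of $G$, and let $R=S^G$ be the invariant ring. Let $V_0=k,V_1,\dots,V_n$ be a complete set of pairwise non-isomorphic irreducible representations of $G$ over $k$ (with $V_0$ the trivial one), and set $M_i=(S\otimes_kV_i)^G$, the invariants for the diagonal action, regarded as an $R$-module through the factor $S$, for $0\le i\le n$. For $e\in\mathbb N$ let ${}^eR$ be the additive group $R$ with the $R$-module structure $r\cdot m=r^{p^e}m$. Then each $M_i$ is an indecomposable $R$-module. Moreover, for every $e\in\mathbb N=\{0,1,2,\dots\}$ the multiplicities in a decomposition of ${}^eR$ into copies of the $M_i$ are uniquely determined: if $c_i,c_i'\ge 0$ $(0\le i\le n)$ are integers with $${}^eR\cong\bigoplus_{i=0}^n M_i^{\oplus c_i}\quad\text{and}\quad {}^eR\cong\bigoplus_{i=0}^n M_i^{\oplus c_i'}$$ as $R$-modules,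 then $c_i=c_i'$ for all $i$. -/

import Mathlib

open scoped TensorProduct DirectSum

universe u v w

noncomputable section

/-! ### The action of `GL(V)` on the symmetric algebra and the invariant ring -/

/-- The action of `GL(V)` on `S = Sym(V)` by `k`-algebra endomorphisms, extending the action of
`GL(V)` on the degree one part `V`. -/
def symAction (k : Type u) (V : Type v) [Field k] [AddCommGroup V] [Module k V] :
    LinearMap.GeneralLinearGroup k V →* (SymmetricAlgebra k V →ₐ[k] SymmetricAlgebra k V) where
  toFun g := SymmetricAlgebra.lift (SymmetricAlgebra.ι k V ∘ₗ (g : V →ₗ[k] V))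
  map_one' := by
    apply SymmetricAlgebra.algHom_ext
    ext x
    simp
  map_mul' g h := by
    apply SymmetricAlgebra.algHom_ext
    ext x
    simp

/-- The invariant ring `R = S^G`, where `S = Sym(V)`. -/
def invariantRing {k : Type u} {V : Type v} [Field k] [AddCommGroup V] [Module k V]
    (G : Subgroup (LinearMap.GeneralLinearGroup k V)) :
    Subalgebra k (SymmetricAlgebra k V) where
  carrier := {s | ∀ g : G, symAction k V g s = s}
  mul_mem' ha hb g := by rw [map_mul, ha g, hb g]
  add_mem' ha hb g := by rw [map_add, ha g, hb g]
  algebraMap_mem' r g := AlgHom.commutes _ r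

/-- The invariant ring of a group acting over a field of characteristic `p` has
characteristic `p`. -/
instance invariantRing.instCharP {k : Type u} {V : Type v} [Field k] [AddCommGroup V] [Module k V]
    (G : Subgroup (LinearMap.GeneralLinearGroup k V)) (p : ℕ) [CharP k p] :
    CharP (invariantRing G) p :=
  charP_of_injective_algebraMap (RingHom.injective (algebraMap k (invariantRing G))) p

/-- A pseudo-reflection: an element `g` of `GL(V)` whose fixed space is a hyperplane, that is,
`g - 1` has rank one. -/
def IsPseudoReflection {k : Type u} {V : Type v} [Field k] [AddCommGroup V] [Module k V]
    (g : LinearMap.GeneralLinearGroup k V) : Prop :=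
  Module.finrank k (LinearMap.range ((g : V →ₗ[k] V) - LinearMap.id)) = 1

/-! ### The modules `(S ⊗ W)^G` -/

/-- For a representation `ρ` of `G ⊆ GL(V)` on `W`, the `R`-module `(S ⊗ W)^G` of invariants for
the diagonal action of `G`, where `R = S^G` acts through the factor `S`. -/
def covariants {k : Type u} {V : Type v} [Field k] [AddCommGroup V] [Module k V]
    (G : Subgroup (LinearMap.GeneralLinearGroup k V))
    {W : Type w} [AddCommGroup W] [Module k W] (ρ : Representation k G W) :
    Submodule (invariantRing G) (SymmetricAlgebra k V ⊗[k] W) where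
  carrier := {x | ∀ g : G, TensorProduct.map (symAction k V g).toLinearMap (ρ g) x = x}
  add_mem' ha hb g := by rw [map_add, ha g, hb g]
  zero_mem' g := map_zero _
  smul_mem' r x hx g := by
    have key : ∀ y : SymmetricAlgebra k V ⊗[k] W,
        TensorProduct.map (symAction k V g).toLinearMap (ρ g) (r • y) =
          r • TensorProduct.map (symAction k V g).toLinearMap (ρ g) y := by
      intro y
      induction y using TensorProduct.induction_on with
      | zero => simp
      | tmul s w =>
        have h : symAction k V g (r : SymmetricAlgebra k V) = r := r.2 g
        simp [TensorProduct.smul_tmul', Subalgebra.smul_def, h]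
      | add a b ha hb => simp only [smul_add, map_add, ha, hb]
    rw [key, hx g]

/-- A family of representations of `G` over `k` is a complete set of pairwise non-isomorphic
irreducible representations of `G`. -/
structure IsCompleteIrreducibleFamily {k : Type u} {G : Type v} [Field k] [Group G] {ι : Type*}
    {W : ι → Type w} [∀ i, AddCommGroup (W i)] [∀ i, Module k (W i)]
    (ρ : ∀ i, Representation k G (W i)) : Prop where
  irreducible : ∀ i, (ρ i).IsIrreducible
  eq_of_equiv : ∀ i j, Nonempty ((ρ i).Equiv (ρ j)) → i = j
  complete : ∀ (U : Type w) [AddCommGroup U] [Module k U] (σ : Representation k G U),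
    σ.IsIrreducible → ∃ i, Nonempty (σ.Equiv (ρ i))

/-! ### Frobenius pull-back and indecomposability -/

/-- The module `ᵉM`: the additive group `M`, on which `a` acts as `a ^ (p ^ e)` acts on `M`. -/
@[nolint unusedArguments]
def FrobeniusPullback (_p _e : ℕ) (M : Type w) : Type w := M

instance FrobeniusPullback.instAddCommGroup (p e : ℕ) (M : Type w) [AddCommGroup M] :
    AddCommGroup (FrobeniusPullback p e M) :=
  inferInstanceAs (AddCommGroup M)

instance FrobeniusPullback.instModule (p e : ℕ) (A : Type v) [CommRing A] [ExpChar A p]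
    (M : Type w) [AddCommGroup M] [Module A M] : Module A (FrobeniusPullback p e M) :=
  Module.compHom M (iterateFrobenius A p e)

/-- A module is indecomposable if it is nonzero and is not the internal direct sum of two nonzero
submodules. -/
def IsIndecomposableModule (A : Type v) [Ring A] (M : Type w) [AddCommGroup M] [Module A M] :
    Prop :=
  Nontrivial M ∧ ∀ N P : Submodule A M, IsCompl N P → N = ⊥ ∨ P = ⊥

end

noncomputable section

/-! ### The symmetric algebra: factoriality, and coprimality of linear forms -/

section SymmetricAlgebra

variable {k : Type u} [Field k] {V : Type v} [AddCommGroup V] [Module k V]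

/-! Taking covariants loses no information about maps. Without pseudo-reflections, `S` is unramified
over `R` in codimension one, so every `R`-linear map `(S ⊗ U)^G → (S ⊗ U')^G` extends uniquely to an
`S`-linear map `S ⊗ U → S ⊗ U'`, which is then `G`-equivariant (`exists_extension`,
`extension_unique`, `extension_diagAction`). Reducing the extension modulo the augmentation ideal of
`S` gives an additive functor (`reduction`) to intertwining maps `U → U'`. By Nakayama's lemma an
idempotent that reduces to zero is zero, so Schur's lemma gives indecomposability. For the
multiplicities, an isomorphism between two sums reduces to matrices of intertwining maps; Schur's
lemma isolates the block of each `W i`, and dimensions are compared.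

The extension is explicit. A Galois family `(a, b)` for `d` satisfies `∑ a * g b = d` or `0`
according to whether `g = 1`, so `∑ a • f (transfer (b • x))` is `d` times the desired value.
Dividing by `d` is possible because the elements `d` of all Galois families have no common factor.
-/

instance SymmetricAlgebra.instUniqueFactorizationMonoid :
    UniqueFactorizationMonoid (SymmetricAlgebra k V) :=
  (SymmetricAlgebra.equivMvPolynomial
    (Module.Basis.ofVectorSpace k V)).toMulEquiv.symm.uniqueFactorizationMonoid inferInstance

theorem SymmetricAlgebra.ι_injective : Function.Injective (SymmetricAlgebra.ι k V) := by
  set b := Module.Basis.ofVectorSpace k V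
  rw [← LinearMap.ker_eq_bot, LinearMap.ker_eq_bot']
  intro x hx
  have h : ((SymmetricAlgebra.equivMvPolynomial b).toLinearMap ∘ₗ SymmetricAlgebra.ι k V) =
      (Finsupp.linearCombination k MvPolynomial.X) ∘ₗ b.repr.toLinearMap := by
    refine b.ext fun i => ?_
    simp
  have h2 := LinearMap.congr_fun h x
  simp only [LinearMap.comp_apply, hx, map_zero] at h2
  have h3 := (MvPolynomial.linearIndependent_X _ k) (h2.symm.trans (map_zero _).symm)
  simpa using h3

/-- `e` divides `gcd (a * c) (b * c)`, which is associated to `gcd a b * c`. -/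
theorem dvd_of_dvd_mul_of_isRelPrime {A : Type*} [CommRing A] [IsDomain A]
    [UniqueFactorizationMonoid A] {a b c e : A} (hab : IsRelPrime a b) (ha : e ∣ a * c)
    (hb : e ∣ b * c) : e ∣ c := by
  classical
  let := UniqueFactorizationMonoid.toGCDMonoid A
  have h := (dvd_gcd ha hb).trans (gcd_mul_right' c a b).dvd
  have hu : IsUnit (gcd a b) := hab (gcd_dvd_left a b) (gcd_dvd_right a b)
  exact (hu.dvd_mul_left).1 h

theorem SymmetricAlgebra.isRelPrime_ι_basis {κ : Type*} (b : Module.Basis κ k V) {i j : κ}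
    (hij : i ≠ j) : IsRelPrime (SymmetricAlgebra.ι k V (b i)) (SymmetricAlgebra.ι k V (b j)) := by
  set E := SymmetricAlgebra.equivMvPolynomial b
  intro d hi hj
  have h1 := map_dvd E hi
  have h2 := map_dvd E hj
  rw [SymmetricAlgebra.equivMvPolynomial_ι_apply] at h1 h2
  have h : IsRelPrime (MvPolynomial.X i : MvPolynomial κ k) (MvPolynomial.X j) := by
    refine (MvPolynomial.X_prime (i := i)).irreducible.isRelPrime_iff_not_dvd.2 ?_
    rwa [MvPolynomial.X_dvd_X]
  exact (MulEquiv.isUnit_map E.toMulEquiv).1 (h h1 h2)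

/-- Extended to a basis, the two vectors become distinct variables of a polynomial ring. -/
theorem SymmetricAlgebra.isRelPrime_ι_of_linearIndependent {x y : V}
    (h : LinearIndependent k ![x, y]) :
    IsRelPrime (SymmetricAlgebra.ι k V x) (SymmetricAlgebra.ι k V y) := by
  have hs : LinearIndepOn k id (Set.range ![x, y]) := h.linearIndepOn_id
  have hmem : ∀ i, ![x, y] i ∈ hs.extend (Set.subset_univ _) := fun i =>
    Module.Basis.subset_extend hs (Set.mem_range_self i)
  have hne : (⟨x, hmem 0⟩ : hs.extend (Set.subset_univ _)) ≠ ⟨y, hmem 1⟩ := fun hxy =>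
    zero_ne_one (h.injective (a₁ := 0) (a₂ := 1) (Subtype.ext_iff.1 hxy))
  simpa using SymmetricAlgebra.isRelPrime_ι_basis (Module.Basis.extend hs) hne

end SymmetricAlgebra

/-! ### The action on the symmetric algebra -/

section Action

variable {k : Type u} [Field k] {V : Type v} [AddCommGroup V] [Module k V]

@[simp]
theorem symAction_ι (g : LinearMap.GeneralLinearGroup k V) (x : V) :
    symAction k V g (SymmetricAlgebra.ι k V x) = SymmetricAlgebra.ι k V ((g : V →ₗ[k] V) x) := by
  simp [symAction]

theorem symAction_mul_apply (g h : LinearMap.GeneralLinearGroup k V) (s : SymmetricAlgebra k V) :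
    symAction k V (g * h) s = symAction k V g (symAction k V h s) := by
  rw [map_mul]; rfl

theorem symAction_inv_apply_self (g : LinearMap.GeneralLinearGroup k V)
    (s : SymmetricAlgebra k V) : symAction k V g⁻¹ (symAction k V g s) = s := by
  rw [← symAction_mul_apply, inv_mul_cancel, map_one]; rfl

theorem symAction_injective (g : LinearMap.GeneralLinearGroup k V) :
    Function.Injective (symAction k V g) :=
  Function.LeftInverse.injective (symAction_inv_apply_self g)

theorem algebraMapInv_symAction (g : LinearMap.GeneralLinearGroup k V)
    (s : SymmetricAlgebra k V) :
    SymmetricAlgebra.algebraMapInv (symAction k V g s) =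
      (SymmetricAlgebra.algebraMapInv s : k) := by
  have : (SymmetricAlgebra.algebraMapInv (R := k) (M := V)).comp (symAction k V g) =
      SymmetricAlgebra.algebraMapInv := by
    apply SymmetricAlgebra.algHom_ext
    ext x
    simp [SymmetricAlgebra.algebraMapInv_ι]
  exact DFunLike.congr_fun this s

/-- An element `g ≠ 1` of `GL(V)` that is not a pseudo-reflection moves two vectors in linearly
independent directions. -/
theorem exists_linearIndependent_of_not_isPseudoReflection [FiniteDimensional k V]
    {g : LinearMap.GeneralLinearGroup k V} (hg1 : g ≠ 1) (hg : ¬ IsPseudoReflection g) :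
    ∃ x y : V, LinearIndependent k ![(g : V →ₗ[k] V) x - x, (g : V →ₗ[k] V) y - y] := by
  set D : V →ₗ[k] V := (g : V →ₗ[k] V) - LinearMap.id with hD
  have h0 : Module.finrank k (LinearMap.range D) ≠ 0 := by
    intro h
    rw [Submodule.finrank_eq_zero, LinearMap.range_eq_bot, hD, sub_eq_zero] at h
    exact hg1 (Units.ext h)
  have h1 : Module.finrank k (LinearMap.range D) ≠ 1 := hg
  have h2 : 2 ≤ Module.finrank k (LinearMap.range D) := by omega
  obtain ⟨f, hf⟩ := exists_linearIndependent_of_le_finrank h2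
  obtain ⟨x, hx⟩ := (f 0).2
  obtain ⟨y, hy⟩ := (f 1).2
  refine ⟨x, y, ?_⟩
  have h3 := hf.map' (LinearMap.range D).subtype (Submodule.ker_subtype _)
  have h4 : ![(g : V →ₗ[k] V) x - x, (g : V →ₗ[k] V) y - y] =
      (LinearMap.range D).subtype ∘ f := by
    ext i
    fin_cases i
    · simpa [hD] using hx
    · simpa [hD] using hy
  rw [h4]
  exact h3

/-- The image of `g - 1` contains two independent vectors, hence two coprime linear forms: the fixed
locus of `g` has codimension at least two. -/
theorem dvd_of_forall_dvd_sub_mul [FiniteDimensional k V]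
    {g : LinearMap.GeneralLinearGroup k V} (hg1 : g ≠ 1) (hg : ¬ IsPseudoReflection g)
    {e c : SymmetricAlgebra k V}
    (h : ∀ x : V, e ∣ SymmetricAlgebra.ι k V ((g : V →ₗ[k] V) x - x) * c) : e ∣ c := by
  obtain ⟨x, y, hxy⟩ := exists_linearIndependent_of_not_isPseudoReflection hg1 hg
  exact dvd_of_dvd_mul_of_isRelPrime
    (SymmetricAlgebra.isRelPrime_ι_of_linearIndependent hxy) (h x) (h y)

variable (G : Subgroup (LinearMap.GeneralLinearGroup k V))

theorem dvd_of_forall_dvd_prod_sub_mul [FiniteDimensional k V] [DecidableEq G]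
    (hG : ∀ g ∈ G, ¬ IsPseudoReflection g) (A : Finset G) (hA : (1 : G) ∉ A)
    {e c : SymmetricAlgebra k V}
    (h : ∀ y : G → V, e ∣ (∏ g ∈ A, SymmetricAlgebra.ι k V
      (((g : LinearMap.GeneralLinearGroup k V) : V →ₗ[k] V) (y g) - y g)) * c) : e ∣ c := by
  induction A using Finset.induction_on with
  | empty => simpa using h 0
  | insert g A hgA ih =>
    refine ih (fun h1 => hA (Finset.mem_insert_of_mem h1)) fun y => ?_
    have hg1 : (g : LinearMap.GeneralLinearGroup k V) ≠ 1 := fun h1 =>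
      hA (Finset.mem_insert.2 (Or.inl (Subtype.ext h1).symm))
    refine dvd_of_forall_dvd_sub_mul hg1 (hG g g.2) fun x => ?_
    -- The vectors attached to different group elements vary independently, so one factor can be
    -- removed while the others stay fixed.
    have h1 := h (Function.update y g x)
    rw [Finset.prod_insert hgA, Function.update_self, mul_assoc] at h1
    convert h1 using 3
    refine Finset.prod_congr rfl fun g' hg' => ?_
    rw [Function.update_of_ne (fun h2 => hgA (by rwa [← h2]))]

variable [Fintype G] [DecidableEq G]

/-- A finite family of pairs `(a, b)` such that `∑ a * g b` is `d` for `g = 1` and vanishes for all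
other `g ∈ G`. -/
def IsGaloisFamily (t : Finset (SymmetricAlgebra k V × SymmetricAlgebra k V))
    (d : SymmetricAlgebra k V) : Prop :=
  ∀ g : G, ∑ i ∈ t, i.1 * symAction k V g i.2 = if g = 1 then d else 0

/-- Apply `a ⊗ b ↦ a * h b` to a product over `g ≠ 1` of factors `g y ⊗ 1 - 1 ⊗ y`, with `y`
depending on `g`. For `h ≠ 1` the factor with `g = h` dies; for `h = 1` each factor becomes `g y -
y`. Writing the product as a sum of pure tensors gives the family. -/
theorem exists_isGaloisFamily (y : G → V) :
    ∃ t, IsGaloisFamily G t (∏ g ∈ Finset.univ.erase (1 : G), SymmetricAlgebra.ι k V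
      (((g : LinearMap.GeneralLinearGroup k V) : V →ₗ[k] V) (y g) - y g)) := by
  let μ (h : G) : SymmetricAlgebra k V ⊗[k] SymmetricAlgebra k V →ₐ[k] SymmetricAlgebra k V :=
    Algebra.TensorProduct.lift (AlgHom.id k _) (symAction k V h) (fun _ _ => Commute.all _ _)
  let z : SymmetricAlgebra k V ⊗[k] SymmetricAlgebra k V :=
    ∏ g ∈ Finset.univ.erase (1 : G),
      (SymmetricAlgebra.ι k V (((g : LinearMap.GeneralLinearGroup k V) : V →ₗ[k] V) (y g)) ⊗ₜ 1
        - 1 ⊗ₜ SymmetricAlgebra.ι k V (y g))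
  obtain ⟨t, ht⟩ := TensorProduct.exists_finset z
  refine ⟨t, fun h => ?_⟩
  have h1 : μ h z = ∑ i ∈ t, i.1 * symAction k V h i.2 := by
    rw [ht, map_sum]
    simp [μ]
  rw [← h1, map_prod]
  split_ifs with hh
  · subst hh
    refine Finset.prod_congr rfl fun g _ => ?_
    simp [μ]
  · exact Finset.prod_eq_zero (Finset.mem_erase.2 ⟨hh, Finset.mem_univ h⟩) (by simp [μ])

theorem exists_isGaloisFamily_ne_zero : ∃ t d, d ≠ 0 ∧ IsGaloisFamily G t d := by
  have h : ∀ g : G, ∃ y : V, g ≠ 1 →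
      ((g : LinearMap.GeneralLinearGroup k V) : V →ₗ[k] V) y - y ≠ 0 := by
    intro g
    by_contra! h
    refine (h 0).1 (Subtype.ext (Units.ext (LinearMap.ext fun x => ?_)))
    exact sub_eq_zero.1 (h x).2
  choose y hy using h
  obtain ⟨t, ht⟩ := exists_isGaloisFamily G y
  refine ⟨t, _, Finset.prod_ne_zero_iff.2 fun g hg => ?_, ht⟩
  rw [Ne, ← map_zero (SymmetricAlgebra.ι k V), SymmetricAlgebra.ι_injective.eq_iff]
  exact hy g (Finset.ne_of_mem_erase hg)

theorem dvd_of_forall_isGaloisFamily [FiniteDimensional k V]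
    (hG : ∀ g ∈ G, ¬ IsPseudoReflection g) {e c : SymmetricAlgebra k V}
    (h : ∀ t d, IsGaloisFamily G t d → e ∣ d * c) : e ∣ c := by
  refine dvd_of_forall_dvd_prod_sub_mul G hG (Finset.univ.erase 1) (by simp) fun y => ?_
  obtain ⟨t, ht⟩ := exists_isGaloisFamily G y
  exact h t _ ht

end Action

/-! ### Extending maps between modules of covariants -/

section Extension

variable {k : Type u} [Field k] {V : Type v} [AddCommGroup V] [Module k V]
  {G : Subgroup (LinearMap.GeneralLinearGroup k V)}
  {U : Type*} [AddCommGroup U] [Module k U] (ρ : Representation k G U)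
  {U' : Type*} [AddCommGroup U'] [Module k U'] (ρ' : Representation k G U')

/-- Shortcut instance. -/
abbrev covariantsModule : Module (invariantRing G) (covariants G ρ) := (covariants G ρ).module

/-- Shortcut instance. -/
abbrev covariantsSMul : SMul (invariantRing G) (covariants G ρ) := (covariants G ρ).smul

/-- Shortcut instance. -/
abbrev symTensorModule : Module (SymmetricAlgebra k V) (SymmetricAlgebra k V ⊗[k] U) :=
  TensorProduct.leftModule

/-- Shortcut instance. -/
abbrev symTensorSMul : SMul (SymmetricAlgebra k V) (SymmetricAlgebra k V ⊗[k] U) :=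
  TensorProduct.leftHasSMul

attribute [local instance] covariantsModule covariantsSMul symTensorModule symTensorSMul

/-- The diagonal action of `G` on `S ⊗ U`. -/
def diagAction (g : G) : SymmetricAlgebra k V ⊗[k] U →ₗ[k] SymmetricAlgebra k V ⊗[k] U :=
  TensorProduct.map (symAction k V g).toLinearMap (ρ g)

@[simp]
theorem diagAction_tmul (g : G) (s : SymmetricAlgebra k V) (u : U) :
    diagAction ρ g (s ⊗ₜ u) = symAction k V g s ⊗ₜ ρ g u := rfl

theorem diagAction_smul (g : G) (s : SymmetricAlgebra k V) (x : SymmetricAlgebra k V ⊗[k] U) :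
    diagAction ρ g (s • x) = symAction k V g s • diagAction ρ g x := by
  induction x using TensorProduct.induction_on with
  | zero => simp
  | tmul a u => simp [TensorProduct.smul_tmul']
  | add a b ha hb => simp only [smul_add, map_add, ha, hb]

theorem diagAction_mul (g h : G) (x : SymmetricAlgebra k V ⊗[k] U) :
    diagAction ρ (g * h) x = diagAction ρ g (diagAction ρ h x) := by
  induction x using TensorProduct.induction_on with
  | zero => simp
  | tmul a u => simp
  | add a b ha hb => simp only [map_add, ha, hb]

theorem diagAction_one (x : SymmetricAlgebra k V ⊗[k] U) : diagAction ρ 1 x = x := by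
  induction x using TensorProduct.induction_on with
  | zero => simp
  | tmul a u => simp
  | add a b ha hb => simp only [map_add, ha, hb]

theorem diagAction_covariants (g : G) (m : covariants G ρ) :
    diagAction ρ g (m : SymmetricAlgebra k V ⊗[k] U) = m := m.2 g

variable [Fintype G]

/-- The transfer `S ⊗ U → (S ⊗ U)^G`. -/
def transfer : SymmetricAlgebra k V ⊗[k] U →+ covariants G ρ where
  toFun x := ⟨∑ g : G, diagAction ρ g x, fun h => by
    change diagAction ρ h _ = _
    simp_rw [map_sum, ← diagAction_mul]
    exact Fintype.sum_equiv (Equiv.mulLeft h) _ _ fun _ => rfl⟩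
  map_zero' := by ext; simp
  map_add' x y := by ext; simp [Finset.sum_add_distrib]

theorem coe_transfer (x : SymmetricAlgebra k V ⊗[k] U) :
    (transfer ρ x : SymmetricAlgebra k V ⊗[k] U) = ∑ g : G, diagAction ρ g x := rfl

/-- The transfer `S → S^G`. -/
def ringTransfer (s : SymmetricAlgebra k V) : invariantRing G :=
  ⟨∑ g : G, symAction k V g s, fun h => by
    simp_rw [map_sum, ← symAction_mul_apply, ← Subgroup.coe_mul]
    exact Fintype.sum_equiv (Equiv.mulLeft h) _ _ fun _ => rfl⟩

theorem transfer_smul_covariants (s : SymmetricAlgebra k V) (m : covariants G ρ) :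
    transfer ρ (s • (m : SymmetricAlgebra k V ⊗[k] U)) =
      ((ringTransfer s : invariantRing G) • m : covariants G ρ) := by
  ext
  simp only [coe_transfer, diagAction_smul, diagAction_covariants, ← Finset.sum_smul]
  rfl

variable {ρ ρ'} {t t' : Finset (SymmetricAlgebra k V × SymmetricAlgebra k V)}
  {d d' : SymmetricAlgebra k V}

variable (t) in
/-- The map `x ↦ ∑ a • f (transfer (b • x))`, which is `d` times the extension of `f` to `S ⊗ U`
if `t` is a Galois family for `d`. -/
def scaledExtension (f : covariants G ρ →ₗ[invariantRing G] covariants G ρ') :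
    SymmetricAlgebra k V ⊗[k] U →+ SymmetricAlgebra k V ⊗[k] U' where
  toFun x := ∑ i ∈ t, i.1 • (f (transfer ρ (i.2 • x)) : SymmetricAlgebra k V ⊗[k] U')
  map_zero' := by simp
  map_add' x y := by simp [Finset.sum_add_distrib]

variable (f : covariants G ρ →ₗ[invariantRing G] covariants G ρ')

theorem scaledExtension_apply (x : SymmetricAlgebra k V ⊗[k] U) :
    scaledExtension t f x =
      ∑ i ∈ t, i.1 • (f (transfer ρ (i.2 • x)) : SymmetricAlgebra k V ⊗[k] U') := rfl

variable [DecidableEq G]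

/-- Exchanging the sums over `t` and `G` leaves only the term `g = 1`. Consequently `d • (S ⊗ U)`
lies in the `S`-span of the covariants. -/
theorem IsGaloisFamily.sum_smul_transfer (ht : IsGaloisFamily G t d)
    (x : SymmetricAlgebra k V ⊗[k] U) :
    ∑ i ∈ t, i.1 • (transfer ρ (i.2 • x) : SymmetricAlgebra k V ⊗[k] U) = d • x := by
  simp_rw [coe_transfer, diagAction_smul, Finset.smul_sum, smul_smul]
  rw [Finset.sum_comm]
  simp_rw [← Finset.sum_smul]
  rw [Finset.sum_eq_single 1]
  · rw [ht 1, if_pos rfl, diagAction_one]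
  · intro g _ hg
    rw [ht g, if_neg hg, zero_smul]
  · simp

theorem IsGaloisFamily.sum_mul_ringTransfer (ht : IsGaloisFamily G t d)
    (s : SymmetricAlgebra k V) :
    ∑ i ∈ t, i.1 * (ringTransfer (i.2 * s) : invariantRing G).1 = d * s := by
  simp_rw [ringTransfer, map_mul, Finset.mul_sum, ← mul_assoc]
  rw [Finset.sum_comm]
  simp_rw [← Finset.sum_mul]
  rw [Finset.sum_eq_single 1]
  · rw [ht 1, if_pos rfl]; simp
  · intro g _ hg
    rw [ht g, if_neg hg, zero_mul]
  · simp

/-- On `S`-multiples of a covariant the transfer only affects the coefficient, which lands in `R`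
and passes through `f`. -/
theorem IsGaloisFamily.scaledExtension_smul_covariants (ht : IsGaloisFamily G t d)
    (s : SymmetricAlgebra k V) (m : covariants G ρ) :
    scaledExtension t f (s • (m : SymmetricAlgebra k V ⊗[k] U)) =
      (d * s) • (f m : SymmetricAlgebra k V ⊗[k] U') := by
  rw [scaledExtension_apply, ← ht.sum_mul_ringTransfer, Finset.sum_smul]
  refine Finset.sum_congr rfl fun i _ => ?_
  rw [smul_smul, transfer_smul_covariants, map_smul, mul_smul]
  rfl

/-- `d' • x` is an `S`-combination of covariants, where the scaled extension is already known.
Linearity, and independence of the family up to the factor `d`, both follow by specialization and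
cancellation. -/
theorem IsGaloisFamily.scaledExtension_smul_smul (ht : IsGaloisFamily G t d)
    (ht' : IsGaloisFamily G t' d')
    (s : SymmetricAlgebra k V) (x : SymmetricAlgebra k V ⊗[k] U) :
    scaledExtension t f ((d' * s) • x) = (d * s) • scaledExtension t' f x := by
  rw [mul_comm, mul_smul, ← ht'.sum_smul_transfer, Finset.smul_sum, map_sum,
    scaledExtension_apply, Finset.smul_sum]
  refine Finset.sum_congr rfl fun i _ => ?_
  rw [smul_smul, ht.scaledExtension_smul_covariants, smul_smul, mul_assoc]

theorem IsGaloisFamily.scaledExtension_smul (ht : IsGaloisFamily G t d) (hd : d ≠ 0)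
    (s : SymmetricAlgebra k V) (x : SymmetricAlgebra k V ⊗[k] U) :
    scaledExtension t f (s • x) = s • scaledExtension t f x := by
  have h1 := ht.scaledExtension_smul_smul f ht s x
  have h2 := ht.scaledExtension_smul_smul f ht 1 (s • x)
  rw [mul_one, smul_smul, h1, mul_smul] at h2
  exact (smul_right_injective _ hd h2).symm

theorem IsGaloisFamily.smul_scaledExtension_comm (ht : IsGaloisFamily G t d)
    (ht' : IsGaloisFamily G t' d') (hd : d ≠ 0) (x : SymmetricAlgebra k V ⊗[k] U) :
    d' • scaledExtension t f x = d • scaledExtension t' f x := by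
  have h := ht.scaledExtension_smul_smul f ht' 1 x
  rwa [mul_one, mul_one, ht.scaledExtension_smul f hd] at h

variable {f}

theorem IsGaloisFamily.smul_map_eq (ht : IsGaloisFamily G t d)
    {F : SymmetricAlgebra k V ⊗[k] U →ₗ[SymmetricAlgebra k V] SymmetricAlgebra k V ⊗[k] U'}
    (hF : ∀ m : covariants G ρ, F m = f m) (x : SymmetricAlgebra k V ⊗[k] U) :
    d • F x = scaledExtension t f x := by
  rw [← map_smul, ← ht.sum_smul_transfer, map_sum, scaledExtension_apply]
  refine Finset.sum_congr rfl fun i _ => ?_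
  rw [map_smul, hF]

end Extension

/-! ### Existence, uniqueness and equivariance of the extension -/

section ExtensionFinite

variable {k : Type u} [Field k] {V : Type v} [AddCommGroup V] [Module k V]
  {G : Subgroup (LinearMap.GeneralLinearGroup k V)} [Finite G]
  {U : Type*} [AddCommGroup U] [Module k U] {ρ : Representation k G U}
  {U' : Type*} [AddCommGroup U'] [Module k U'] {ρ' : Representation k G U'}
  (f : covariants G ρ →ₗ[invariantRing G] covariants G ρ')

/-- If `G` contains no pseudo-reflections, every map between modules of covariants extends to a
map of free `S`-modules. -/
theorem exists_extension [FiniteDimensional k V] (hG : ∀ g ∈ G, ¬ IsPseudoReflection g) :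
    ∃ F : SymmetricAlgebra k V ⊗[k] U →ₗ[SymmetricAlgebra k V] SymmetricAlgebra k V ⊗[k] U',
      ∀ m : covariants G ρ, F m = f m := by
  classical
  have := Fintype.ofFinite G
  obtain ⟨t, d, hd, ht⟩ := exists_isGaloisFamily_ne_zero G
  let B' := (Module.Basis.ofVectorSpace k U').baseChange (SymmetricAlgebra k V)
  let B := (Module.Basis.ofVectorSpace k U).baseChange (SymmetricAlgebra k V)
  have hdvd : ∀ x, ∃ y, scaledExtension t f x = d • y := by
    intro x
    -- For every Galois family for `d'`, `d' * (coordinate)` is `d` times a coordinate of the other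
    -- scaled extension; coprimality of the `d'` then forces `d` to divide the coordinate.
    have h : ∀ j, d ∣ B'.repr (scaledExtension t f x) j := by
      intro j
      refine dvd_of_forall_isGaloisFamily G hG fun t' d' ht' =>
        ⟨B'.repr (scaledExtension t' f x) j, ?_⟩
      have h1 := congrArg (fun z => B'.repr z j) (ht.smul_scaledExtension_comm f ht' hd x)
      simpa using h1
    choose c hc using h
    refine ⟨∑ j ∈ (B'.repr (scaledExtension t f x)).support, c j • B' j, ?_⟩
    conv_lhs => rw [← B'.linearCombination_repr (scaledExtension t f x),
      Finsupp.linearCombination_apply, Finsupp.sum]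
    rw [Finset.smul_sum]
    exact Finset.sum_congr rfl fun j _ => by rw [hc j, mul_smul]
  choose q hq using hdvd
  let Φ : SymmetricAlgebra k V ⊗[k] U →ₗ[SymmetricAlgebra k V] SymmetricAlgebra k V ⊗[k] U' :=
    { scaledExtension t f with map_smul' := ht.scaledExtension_smul f hd }
  have hΦ : d • B.constr (SymmetricAlgebra k V) (fun j => q (B j)) = Φ := by
    refine B.ext fun j => ?_
    rw [LinearMap.smul_apply, Module.Basis.constr_basis, ← hq]
    rfl
  refine ⟨B.constr (SymmetricAlgebra k V) (fun j => q (B j)), fun m => ?_⟩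
  refine smul_right_injective _ hd ?_
  have h := ht.scaledExtension_smul_covariants f 1 m
  rw [one_smul, mul_one] at h
  exact (LinearMap.congr_fun hΦ m).trans h

variable {f}

theorem extension_unique
    {F F' : SymmetricAlgebra k V ⊗[k] U →ₗ[SymmetricAlgebra k V] SymmetricAlgebra k V ⊗[k] U'}
    (hF : ∀ m : covariants G ρ, F m = f m) (hF' : ∀ m : covariants G ρ, F' m = f m) :
    F = F' := by
  classical
  have := Fintype.ofFinite G
  obtain ⟨t, d, hd, ht⟩ := exists_isGaloisFamily_ne_zero G
  refine LinearMap.ext fun x => ?_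
  exact smul_right_injective _ hd ((ht.smul_map_eq hF x).trans (ht.smul_map_eq hF' x).symm)

theorem extension_diagAction
    {F : SymmetricAlgebra k V ⊗[k] U →ₗ[SymmetricAlgebra k V] SymmetricAlgebra k V ⊗[k] U'}
    (hF : ∀ m : covariants G ρ, F m = f m) (g : G) (x : SymmetricAlgebra k V ⊗[k] U) :
    F (diagAction ρ g x) = diagAction ρ' g (F x) := by
  classical
  have := Fintype.ofFinite G
  obtain ⟨t, d, hd, ht⟩ := exists_isGaloisFamily_ne_zero G
  -- After multiplication by `g d`, the argument `g (d • x)` is an `S`-combination of covariants,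
  -- which `g` fixes and on which `F` is `f`.
  have hd' : symAction k V g d ≠ 0 := (map_ne_zero_iff _ (symAction_injective _)).2 hd
  refine smul_right_injective _ hd' ?_
  dsimp only
  rw [← map_smul, ← diagAction_smul, ← diagAction_smul, ht.smul_map_eq hF,
    ← ht.sum_smul_transfer (ρ := ρ), scaledExtension_apply]
  simp_rw [map_sum, diagAction_smul, diagAction_covariants]
  refine Finset.sum_congr rfl fun i _ => ?_
  rw [map_smul, hF]

end ExtensionFinite

/-! ### Irreducible representations of finite groups -/

section Irreducible

variable {k : Type u} [Field k] {G : Type*} [Group G] {U : Type*} [AddCommGroup U] [Module k U]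
  {ρ : Representation k G U}

theorem Representation.IsIrreducible.nontrivial (h : ρ.IsIrreducible) : Nontrivial U := by
  have := h
  by_contra hU
  rw [not_nontrivial_iff_subsingleton] at hU
  refine bot_ne_top (α := Subrepresentation ρ) (Subrepresentation.toSubmodule_injective ?_)
  exact Subsingleton.elim _ _

theorem Representation.IsIrreducible.finiteDimensional [Finite G] (h : ρ.IsIrreducible) :
    FiniteDimensional k U := by
  have := h
  obtain ⟨u, hu⟩ := @exists_ne U h.nontrivial 0
  let N : Subrepresentation ρ :=
    { toSubmodule := Submodule.span k (Set.range fun g => ρ g u)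
      apply_mem_toSubmodule := fun g v hv => by
        induction hv using Submodule.span_induction with
        | mem x hx =>
          obtain ⟨g', rfl⟩ := hx
          refine Submodule.subset_span ⟨g * g', ?_⟩
          simp
        | zero => simp
        | add x y _ _ hx hy => rw [map_add]; exact add_mem hx hy
        | smul a x _ hx => rw [map_smul]; exact Submodule.smul_mem _ _ hx }
  have hN : N.toSubmodule ≠ ⊥ := fun h0 =>
    hu ((Submodule.eq_bot_iff _).1 h0 u (Submodule.subset_span ⟨1, by simp⟩))
  have hT : N.toSubmodule = ⊤ := by
    rcases eq_bot_or_eq_top N with h1 | h1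
    · exact absurd (congrArg Subrepresentation.toSubmodule h1) hN
    · exact congrArg Subrepresentation.toSubmodule h1
  refine ⟨?_⟩
  rw [← hT]
  exact Submodule.fg_span (Set.finite_range _)

end Irreducible

/-! ### Decompositions detected by a functor to representations -/

section Indecomposable

variable {A M : Type*} [Ring A] [AddCommGroup M] [Module A M]
  {k : Type*} [Field k] {G : Type*} [Group G] {U : Type*} [AddCommGroup U] [Module k U]
  {ρ : Representation k G U}

/-- The projection onto a summand reduces to an idempotent intertwining map, which by Schur is zero
or injective. An injective idempotent is the identity, so the projection or its complement reduces
to zero and hence vanishes. -/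
theorem isIndecomposableModule_of_reduction (hρ : ρ.IsIrreducible)
    (red : (M →ₗ[A] M) →+ ρ.IntertwiningMap ρ) (red_id : ∀ u, red LinearMap.id u = u)
    (red_comp : ∀ (f f' : M →ₗ[A] M) u, red (f' ∘ₗ f) u = red f' (red f u))
    (hred : ∀ f : M →ₗ[A] M, f ∘ₗ f = f → red f = 0 → f = 0) :
    IsIndecomposableModule A M := by
  have := hρ
  have := hρ.nontrivial
  refine ⟨?_, fun N P hNP => ?_⟩
  · by_contra h
    rw [not_nontrivial_iff_subsingleton] at h
    obtain ⟨u, hu⟩ := exists_ne (0 : U)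
    refine hu ?_
    rw [← red_id u, Subsingleton.elim (LinearMap.id : M →ₗ[A] M) 0, map_zero]
    rfl
  · set f := N.projection P hNP
    have hf : f ∘ₗ f = f := Submodule.isIdempotentElem_projection hNP
    rcases Representation.IsIrreducible.injective_or_eq_zero (red f) with h | h
    · right
      have h1 : (LinearMap.id - f) ∘ₗ (LinearMap.id - f) = LinearMap.id - f :=
        IsIdempotentElem.one_sub (R := Module.End A M) hf
      have h2 : red (LinearMap.id - f) = 0 := by
        rw [map_sub]
        refine Representation.IntertwiningMap.ext (LinearMap.ext fun u => ?_)
        change red LinearMap.id u - red f u = 0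
        rw [red_id, sub_eq_zero]
        refine h ?_
        rw [← red_comp, hf]
      rw [← Submodule.ker_projection hNP, show N.projection P hNP = LinearMap.id from
        (sub_eq_zero.1 (hred _ h1 h2)).symm, LinearMap.ker_id]
    · left
      rw [← Submodule.range_projection hNP, show N.projection P hNP = 0 from hred f hf h,
        LinearMap.range_zero]

end Indecomposable

/-! ### Comparison of multiplicities through an additive functor -/

section Multiplicities

variable {A : Type*} [Ring A] {κ : Type*} [DecidableEq κ]
  {M : κ → Type*} [∀ i, AddCommGroup (M i)] [∀ i, Module A (M i)]

variable (A M) in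
/-- The inclusion of one of the summands of `⨁ i, M i ^ c i`. -/
def multInclusion (c : κ → ℕ) (i : κ) (a : Fin (c i)) : M i →ₗ[A] ⨁ i, (Fin (c i) → M i) :=
  DirectSum.lof A κ (fun i => Fin (c i) → M i) i ∘ₗ LinearMap.single A (fun _ => M i) a

variable (A M) in
/-- The projection to one of the summands of `⨁ i, M i ^ c i`. -/
def multProjection (c : κ → ℕ) (i : κ) (a : Fin (c i)) : (⨁ i, (Fin (c i) → M i)) →ₗ[A] M i :=
  LinearMap.proj a ∘ₗ DirectSum.component A κ (fun i => Fin (c i) → M i) i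

theorem multProjection_comp_multInclusion (c : κ → ℕ) (i : κ) (a b : Fin (c i)) :
    multProjection A M c i b ∘ₗ multInclusion A M c i a = if a = b then LinearMap.id else 0 := by
  refine LinearMap.ext fun m => ?_
  simp only [multProjection, multInclusion, LinearMap.comp_apply, DirectSum.component.lof_self]
  split_ifs with h
  · subst h; simp
  · simp [Ne.symm h]

variable [Fintype κ]

theorem sum_multInclusion_comp_multProjection (c : κ → ℕ) :
    ∑ i, ∑ a, multInclusion A M c i a ∘ₗ multProjection A M c i a = LinearMap.id := by
  refine LinearMap.ext fun x => ?_
  simp only [LinearMap.sum_apply, LinearMap.comp_apply, multInclusion, multProjection,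
    LinearMap.id_apply, ← map_sum]
  conv_rhs => rw [← DirectSum.sum_univ_of x]
  refine Finset.sum_congr rfl fun i _ => congrArg _ ?_
  exact LinearMap.sum_single_apply _ _

variable {k : Type*} [Field k] {G : Type*} [Group G] {W : κ → Type*} [∀ i, AddCommGroup (W i)]
  [∀ i, Module k (W i)] {ρ : ∀ i, Representation k G (W i)}

/-- The `(i, i)` blocks `P` of `φ` and `Q` of `ψ` reduce to matrices of intertwining maps with `Q ∘
P = id`, so `W i ^ c i` embeds in `W i ^ c' i`. -/
theorem multiplicity_le_of_comp_eq_id [∀ i, FiniteDimensional k (W i)]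
    (hirr : ∀ i, (ρ i).IsIrreducible)
    (hne : ∀ i j, Nonempty ((ρ i).Equiv (ρ j)) → i = j)
    (red : ∀ i j, (M i →ₗ[A] M j) →+ (ρ i).IntertwiningMap (ρ j))
    (red_id : ∀ i w, red i i LinearMap.id w = w)
    (red_comp : ∀ i j l (f : M i →ₗ[A] M j) (f' : M j →ₗ[A] M l) w,
      red i l (f' ∘ₗ f) w = red j l f' (red i j f w))
    {c c' : κ → ℕ} (φ : (⨁ i, (Fin (c i) → M i)) →ₗ[A] ⨁ i, (Fin (c' i) → M i))
    (ψ : (⨁ i, (Fin (c' i) → M i)) →ₗ[A] ⨁ i, (Fin (c i) → M i))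
    (h : ψ ∘ₗ φ = LinearMap.id) (i : κ) : c i ≤ c' i := by
  let P (a : Fin (c i)) (b : Fin (c' i)) := red i i
    (multProjection A M c' i b ∘ₗ φ ∘ₗ multInclusion A M c i a)
  let Q (b : Fin (c' i)) (a : Fin (c i)) := red i i
    (multProjection A M c i a ∘ₗ ψ ∘ₗ multInclusion A M c' i b)
  have hPQ : ∀ (a a' : Fin (c i)) (w : W i),
      ∑ b, Q b a' (P a b w) = if a = a' then w else 0 := by
    intro a a' w
    have h1 : multProjection A M c i a' ∘ₗ multInclusion A M c i a =
        ∑ j, ∑ b, (multProjection A M c i a' ∘ₗ ψ ∘ₗ multInclusion A M c' j b) ∘ₗ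
          (multProjection A M c' j b ∘ₗ φ ∘ₗ multInclusion A M c i a) := by
      have h2 : multProjection A M c i a' ∘ₗ multInclusion A M c i a =
          multProjection A M c i a' ∘ₗ ψ ∘ₗ
            (∑ j, ∑ b, multInclusion A M c' j b ∘ₗ multProjection A M c' j b) ∘ₗ
              φ ∘ₗ multInclusion A M c i a := by
        rw [sum_multInclusion_comp_multProjection, LinearMap.id_comp, ← LinearMap.comp_assoc _ φ ψ,
          h, LinearMap.id_comp]
      rw [h2]
      refine LinearMap.ext fun m => ?_
      simp only [LinearMap.comp_apply, LinearMap.sum_apply, map_sum]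
    have h3 : red i i (multProjection A M c i a' ∘ₗ multInclusion A M c i a) w =
        if a = a' then w else 0 := by
      rw [multProjection_comp_multInclusion]
      split_ifs
      · exact red_id i w
      · rw [map_zero]; rfl
    rw [← h3, h1]
    simp only [map_sum, Representation.IntertwiningMap.sum_apply, red_comp]
    -- A composite through `M j` with `j ≠ i` reduces to zero by Schur's lemma.
    rw [Finset.sum_eq_single i]
    · intro j _ hji
      refine Finset.sum_eq_zero fun b _ => ?_
      have := hirr i
      have := hirr j
      have : IsEmpty ((ρ i).Equiv (ρ j)) := ⟨fun e => hji (hne i j ⟨e⟩).symm⟩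
      rw [Subsingleton.elim (red i j _) 0]
      exact map_zero _
    · simp
  let Φ : (Fin (c i) → W i) →ₗ[k] (Fin (c' i) → W i) :=
    LinearMap.pi fun b => ∑ a, (P a b).toLinearMap ∘ₗ LinearMap.proj a
  have hΦ : Function.Injective Φ := by
    rw [← LinearMap.ker_eq_bot, LinearMap.ker_eq_bot']
    intro w hw
    ext a'
    have h1 : ∀ b, ∑ a, P a b (w a) = 0 := fun b => by
      simpa [Φ, LinearMap.sum_apply] using congrFun hw b
    have h2 : w a' = ∑ a, if a = a' then w a else 0 := by simp
    simp_rw [h2, ← hPQ]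
    rw [Finset.sum_comm]
    simp_rw [← map_sum, h1, map_zero]
    simp
  have hle := LinearMap.finrank_le_finrank_of_injective hΦ
  have := (hirr i).nontrivial
  rw [Module.finrank_pi_fintype, Module.finrank_pi_fintype] at hle
  simp only [Finset.sum_const, Finset.card_univ, Fintype.card_fin, smul_eq_mul] at hle
  exact Nat.le_of_mul_le_mul_right hle Module.finrank_pos

end Multiplicities

/-! ### Reduction modulo the augmentation ideal -/

section Reduction

variable {k : Type u} [Field k] {V : Type v} [AddCommGroup V] [Module k V]
  {G : Subgroup (LinearMap.GeneralLinearGroup k V)}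
  {U : Type*} [AddCommGroup U] [Module k U] {ρ : Representation k G U}
  {U' : Type*} [AddCommGroup U'] [Module k U'] {ρ' : Representation k G U'}
  {U'' : Type*} [AddCommGroup U''] [Module k U''] {ρ'' : Representation k G U''}

attribute [local instance] covariantsModule covariantsSMul symTensorModule symTensorSMul

variable (k V U) in
/-- The reduction `S ⊗ U → U` modulo the augmentation ideal. -/
def augmentation : SymmetricAlgebra k V ⊗[k] U →ₗ[k] U :=
  (TensorProduct.lid k U).toLinearMap ∘ₗ
    TensorProduct.map (SymmetricAlgebra.algebraMapInv (R := k) (M := V)).toLinearMap LinearMap.id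

@[simp]
theorem augmentation_tmul (s : SymmetricAlgebra k V) (u : U) :
    augmentation k V U (s ⊗ₜ u) = SymmetricAlgebra.algebraMapInv s • u := by
  simp [augmentation]

theorem augmentation_smul (s : SymmetricAlgebra k V) (x : SymmetricAlgebra k V ⊗[k] U) :
    augmentation k V U (s • x) = SymmetricAlgebra.algebraMapInv s • augmentation k V U x := by
  induction x using TensorProduct.induction_on with
  | zero => simp
  | tmul a u => simp [TensorProduct.smul_tmul', mul_smul]
  | add a b ha hb => simp only [smul_add, map_add, ha, hb]

theorem augmentation_diagAction (g : G) (x : SymmetricAlgebra k V ⊗[k] U) :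
    augmentation k V U (diagAction ρ g x) = ρ g (augmentation k V U x) := by
  induction x using TensorProduct.induction_on with
  | zero => simp
  | tmul a u => simp [algebraMapInv_symAction]
  | add a b ha hb => simp only [map_add, ha, hb]

theorem sub_one_tmul_augmentation_mem (x : SymmetricAlgebra k V ⊗[k] U) :
    x - 1 ⊗ₜ augmentation k V U x ∈
      (RingHom.ker (SymmetricAlgebra.algebraMapInv (R := k) (M := V)) •
        (⊤ : Submodule (SymmetricAlgebra k V) (SymmetricAlgebra k V ⊗[k] U))) := by
  induction x using TensorProduct.induction_on with
  | zero => simp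
  | tmul s u =>
    have h : s ⊗ₜ[k] u - 1 ⊗ₜ augmentation k V U (s ⊗ₜ u) =
        (s - algebraMap k _ (SymmetricAlgebra.algebraMapInv s)) •
          ((1 : SymmetricAlgebra k V) ⊗ₜ[k] u) := by
      rw [augmentation_tmul, TensorProduct.smul_tmul', smul_eq_mul, mul_one,
        TensorProduct.sub_tmul, TensorProduct.tmul_smul, Algebra.algebraMap_eq_smul_one,
        TensorProduct.smul_tmul']
    rw [h]
    refine Submodule.smul_mem_smul ?_ trivial
    rw [RingHom.mem_ker, map_sub, SymmetricAlgebra.algebraMap_leftInverse, sub_self]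
  | add a b ha hb =>
    rw [map_add, TensorProduct.tmul_add, add_sub_add_comm]
    exact add_mem ha hb

/-- The reduction of a map of free `S`-modules modulo the augmentation ideal. -/
def reduceMap
    (F : SymmetricAlgebra k V ⊗[k] U →ₗ[SymmetricAlgebra k V] SymmetricAlgebra k V ⊗[k] U') :
    U →ₗ[k] U' :=
  augmentation k V U' ∘ₗ F.restrictScalars k ∘ₗ TensorProduct.mk k _ U 1

theorem augmentation_map
    (F : SymmetricAlgebra k V ⊗[k] U →ₗ[SymmetricAlgebra k V] SymmetricAlgebra k V ⊗[k] U')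
    (x : SymmetricAlgebra k V ⊗[k] U) :
    augmentation k V U' (F x) = reduceMap F (augmentation k V U x) := by
  induction x using TensorProduct.induction_on with
  | zero => simp
  | tmul s u =>
    have h : s ⊗ₜ[k] u = s • ((1 : SymmetricAlgebra k V) ⊗ₜ[k] u) := by
      rw [TensorProduct.smul_tmul', smul_eq_mul, mul_one]
    rw [augmentation_tmul, map_smul, h, map_smul, augmentation_smul]
    rfl
  | add a b ha hb => simp only [map_add, ha, hb]

/-- An idempotent endomorphism of `S ⊗ U` that vanishes modulo the augmentation ideal is zero. -/
theorem eq_zero_of_reduceMap_eq_zero [FiniteDimensional k U]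
    {F : SymmetricAlgebra k V ⊗[k] U →ₗ[SymmetricAlgebra k V] SymmetricAlgebra k V ⊗[k] U}
    (hF : ∀ x, F (F x) = F x) (h0 : reduceMap F = 0) : F = 0 := by
  set I := RingHom.ker (SymmetricAlgebra.algebraMapInv (R := k) (M := V))
  -- Here `F x` lies in `I • ⊤`; applying `F` once more and using idempotence places it in `I •
  -- range F`.
  have hle : LinearMap.range F ≤ I • LinearMap.range F := by
    rintro _ ⟨x, rfl⟩
    have h1 := sub_one_tmul_augmentation_mem (F x)
    rw [augmentation_map, h0, LinearMap.zero_apply, TensorProduct.tmul_zero, sub_zero] at h1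
    have h2 := Submodule.mem_map_of_mem (f := F) h1
    rwa [Submodule.map_smul'', Submodule.map_top, hF] at h2
  have hfg : (LinearMap.range F).FG := by
    rw [LinearMap.range_eq_map]
    exact (Module.Finite.fg_top).map F
  -- Nakayama's lemma without a local ring: some `r ≡ 1` modulo `I` kills the range. As `r ≠ 0` and
  -- `S ⊗ U` is torsion-free, the range is zero.
  obtain ⟨r, hr, h⟩ := Submodule.exists_sub_one_mem_and_smul_eq_zero_of_fg_of_le_smul I _ hfg hle
  have hr0 : r ≠ 0 := by
    rintro rfl
    rw [RingHom.mem_ker] at hr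
    simp at hr
  refine LinearMap.ext fun x => smul_right_injective _ hr0 ?_
  simpa using h (F x) ⟨x, rfl⟩

variable [Finite G] [FiniteDimensional k V] (hG : ∀ g ∈ G, ¬ IsPseudoReflection g)

/-- The extension of a map of modules of covariants to free `S`-modules. -/
def extension (f : covariants G ρ →ₗ[invariantRing G] covariants G ρ') :
    SymmetricAlgebra k V ⊗[k] U →ₗ[SymmetricAlgebra k V] SymmetricAlgebra k V ⊗[k] U' :=
  (exists_extension f hG).choose

theorem extension_apply_coe (f : covariants G ρ →ₗ[invariantRing G] covariants G ρ')
    (m : covariants G ρ) : extension hG f m = f m :=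
  (exists_extension f hG).choose_spec m

theorem extension_id : extension hG (LinearMap.id : covariants G ρ →ₗ[invariantRing G] _) =
    LinearMap.id :=
  extension_unique (extension_apply_coe hG _) fun _ => rfl

theorem extension_comp (f' : covariants G ρ' →ₗ[invariantRing G] covariants G ρ'')
    (f : covariants G ρ →ₗ[invariantRing G] covariants G ρ') :
    extension hG (f' ∘ₗ f) = extension hG f' ∘ₗ extension hG f :=
  extension_unique (extension_apply_coe hG _) fun m => by
    rw [LinearMap.comp_apply, extension_apply_coe, extension_apply_coe, LinearMap.comp_apply]

theorem extension_add (f f' : covariants G ρ →ₗ[invariantRing G] covariants G ρ') :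
    extension hG (f + f') = extension hG f + extension hG f' :=
  extension_unique (extension_apply_coe hG _) fun m => by
    rw [LinearMap.add_apply, extension_apply_coe, extension_apply_coe, LinearMap.add_apply]
    rfl

theorem extension_injective : Function.Injective (extension hG :
    (covariants G ρ →ₗ[invariantRing G] covariants G ρ') → _) := fun f f' h => by
  refine LinearMap.ext fun m => Subtype.ext ?_
  rw [← extension_apply_coe hG, h, extension_apply_coe]

/-- The reduction of maps of modules of covariants to maps of representations. -/
def reduction : (covariants G ρ →ₗ[invariantRing G] covariants G ρ') →+
    Representation.IntertwiningMap ρ ρ' :=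
  AddMonoidHom.mk' (fun f => (reduceMap (extension hG f)).intertwiningMap_of_isIntertwiningMap ρ ρ'
    fun g u => by
      have h := augmentation_map (extension hG f) (diagAction ρ g (1 ⊗ₜ u))
      rw [extension_diagAction (extension_apply_coe hG f), augmentation_diagAction,
        augmentation_map, augmentation_diagAction] at h
      simpa using h.symm)
    fun f f' => by
      refine Representation.IntertwiningMap.ext ?_
      change reduceMap (extension hG (f + f')) = reduceMap _ + reduceMap _
      rw [extension_add]
      refine LinearMap.ext fun u => ?_
      exact map_add (augmentation k V U') _ _

theorem reduction_apply (f : covariants G ρ →ₗ[invariantRing G] covariants G ρ') (u : U) :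
    reduction hG f u = augmentation k V U' (extension hG f (1 ⊗ₜ u)) := rfl

theorem reduction_id_apply (u : U) :
    reduction hG (LinearMap.id : covariants G ρ →ₗ[invariantRing G] _) u = u := by
  rw [reduction_apply, extension_id]
  simp

theorem reduction_comp_apply (f' : covariants G ρ' →ₗ[invariantRing G] covariants G ρ'')
    (f : covariants G ρ →ₗ[invariantRing G] covariants G ρ') (u : U) :
    reduction hG (f' ∘ₗ f) u = reduction hG f' (reduction hG f u) := by
  rw [reduction_apply, extension_comp, LinearMap.comp_apply, augmentation_map]
  rfl

theorem eq_zero_of_reduction_eq_zero (hG : ∀ g ∈ G, ¬ IsPseudoReflection g)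
    [FiniteDimensional k U]
    {f : covariants G ρ →ₗ[invariantRing G] covariants G ρ} (hf : f ∘ₗ f = f)
    (h0 : reduction hG f = 0) : f = 0 := by
  refine extension_injective hG (ρ := ρ) (ρ' := ρ) ?_
  have hE : ∀ x, extension hG f (extension hG f x) = extension hG f x := fun x => by
    rw [← LinearMap.comp_apply, ← extension_comp, hf]
  have h1 := eq_zero_of_reduceMap_eq_zero hE
    (congrArg Representation.IntertwiningMap.toLinearMap h0)
  rw [h1]
  exact extension_unique (ρ := ρ) (ρ' := ρ) (f := 0) (fun _ => rfl) (extension_apply_coe hG 0)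

theorem isIndecomposableModule_covariants (hG : ∀ g ∈ G, ¬ IsPseudoReflection g)
    (hρ : ρ.IsIrreducible) : IsIndecomposableModule (invariantRing G) (covariants G ρ) :=
  have := hρ.finiteDimensional
  isIndecomposableModule_of_reduction hρ (reduction hG) (reduction_id_apply hG)
    (fun f f' => reduction_comp_apply hG f' f) (fun _ => eq_zero_of_reduction_eq_zero hG)

end Reduction

set_option maxHeartbeats 1000000 in
set_option synthInstance.maxHeartbeats 200000 in
theorem multiplicity_le_of_linearEquiv {k : Type u} [Field k]
    {V : Type v} [AddCommGroup V] [Module k V] [FiniteDimensional k V]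
    {G : Subgroup (LinearMap.GeneralLinearGroup k V)} [Finite G]
    (hG : ∀ g ∈ G, ¬ IsPseudoReflection g)
    {κ : Type*} [Fintype κ] [DecidableEq κ]
    {W : κ → Type w} [∀ i, AddCommGroup (W i)] [∀ i, Module k (W i)]
    {ρ : ∀ i, Representation k G (W i)} (hρ : IsCompleteIrreducibleFamily ρ) {c c' : κ → ℕ}
    (θ : (⨁ i, (Fin (c i) → covariants G (ρ i))) ≃ₗ[invariantRing G]
      ⨁ i, (Fin (c' i) → covariants G (ρ i))) (i : κ) : c i ≤ c' i :=
  have : ∀ i, FiniteDimensional k (W i) := fun i => (hρ.irreducible i).finiteDimensional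
  multiplicity_le_of_comp_eq_id (M := fun i => covariants G (ρ i)) hρ.irreducible hρ.eq_of_equiv
    (fun _ _ => reduction hG) (fun _ => reduction_id_apply hG)
    (fun _ _ _ f f' => reduction_comp_apply hG f' f)
    θ.toLinearMap θ.symm.toLinearMap (LinearMap.ext θ.symm_apply_apply) i

end

theorem mainTheorem3 {k : Type u} [Field k] [IsAlgClosed k] (p : ℕ) [Fact p.Prime] [CharP k p]
    {V : Type v} [AddCommGroup V] [Module k V] [FiniteDimensional k V]
    (G : Subgroup (LinearMap.GeneralLinearGroup k V)) [Finite G]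
    (hpG : ¬ p ∣ Nat.card G)
    (hG : ∀ g ∈ G, ¬ IsPseudoReflection g)
    (n : ℕ) (W : Fin (n + 1) → Type w) [∀ i, AddCommGroup (W i)] [∀ i, Module k (W i)]
    (ρ : ∀ i, Representation k G (W i))
    (hρ : IsCompleteIrreducibleFamily ρ)
    (hρ₀ : Nonempty ((ρ 0).Equiv (Representation.trivial k G k))) :
    (∀ i, IsIndecomposableModule (invariantRing G) (covariants G (ρ i))) ∧
    ∀ (e : ℕ) (c c' : Fin (n + 1) → ℕ),
      Nonempty (FrobeniusPullback p e (invariantRing G) ≃ₗ[invariantRing G]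
        ⨁ i, (Fin (c i) → covariants G (ρ i))) →
      Nonempty (FrobeniusPullback p e (invariantRing G) ≃ₗ[invariantRing G]
        ⨁ i, (Fin (c' i) → covariants G (ρ i))) →
      c = c' := by
  refine ⟨fun i => isIndecomposableModule_covariants hG (hρ.irreducible i), ?_⟩
  rintro e c c' ⟨φ⟩ ⟨ψ⟩
  -- Passing through `ᵉR` identifies the two direct sums, and each direction of the identification
  -- gives one inequality.
  exact funext fun i => le_antisymm (multiplicity_le_of_linearEquiv hG hρ (φ.symm.trans ψ) i)
    (multiplicity_le_of_linearEquiv hG hρ (ψ.symm.trans φ) i)
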